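/- Let $\mathbb{K}$ be an algebraically closed field of characteristic $0$, and let $p\in\mathbb{K}[x,y]\setminus(\mathbb{K}[x]\cup\mathbb{K}[y])$ be irreducible. Let $\mathbb{K}[x,y]_p$ be the ring of rational functions in $\mathbb{K}(x,y)$ whose reduced denominator is not divisible by $p$. Let $r\in\mathbb{K}[x,y]_p$, and let $f\in\mathbb{K}(x)$, $g\in\mathbb{K}(y)$ be such that $r+qp=f-g$ for some $q\in\mathbb{K}[x,y]_p$. Let $C\subseteq\mathbb{P}^1(\mathbb{K})\times\mathbb{P}^1(\mathbb{K})$ be the curve defined by the bi-homogenization $x_0^{\deg_x p}y_0^{\deg_y p}\,p(x_1/x_0,y_1/y_0)$, where $\mathbb{P}^1(\mathbb{K})=\mathbb{K}\cup\{\infty\}$. The point $(\infty,\infty)$, when it lies on $C$, is called a pole of $r$ if there is a Puiseux series $\varphi\in\mathbb{K}\{\{x^{-1}\}\}$ with $p(x,\varphi)=0$, $\deg\varphi>0$ and $\deg r(x,\varphi)>0$. A general point $(s_1,s_2)$ is called a pole of $r$ if there is a pair $T=(T_1,T_2)$ of fractional linear transformations of $\mathbb{P}^1(\mathbb{K})$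 which maps $(s_1,s_2)$ to $(\infty,\infty)$ and is such that $(\infty,\infty)$ is a pole, in the previous sense, of $r\circ T^{-1}$ on the curve of the numerator of $p\circ T^{-1}$. The orbit of a point of $C$ is its class under the smallest equivalence relation on $C$ with $(a,b)\sim(c,d)$ whenever $a=c$ or $b=d$. The graph of an orbit has the elements of the orbit as its vertices, and two distinct vertices are adjacent if they share a common coordinate. A path is a sequence of vertices any two consecutive members of which are adjacent; it contains no cycle if no vertex occurs in it twice. Let $(s_1,s_2)\in C$ be a pole of $r$, and let $v_0,v_1,v_2,\dots$ be an infinite path in the graph of its orbit that starts at $v_0=(s_1,s_2)$, contains no cycle, and does not contain a pole of $r$ other than $(s_1,s_2)$. Then: 1. $s_1$ is not a pole of $f$, or $s_2$ is not a pole of $g$. 2. If the first coordinate of $v_1$ equals $s_1$, then $s_1$ is not a pole of $f$. 3. If the second coordinate of $v_1$ equals $s_2$, then $s_2$ is not a pole of $g$. -/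

import Mathlib

open scoped OnePoint

noncomputable section

namespace SepVar

/-- The polynomial ring `K[x,y]`; the variable `x` has index `0`, the variable `y` index `1`. -/
abbrev Poly2 (K : Type*) [Field K] : Type _ := MvPolynomial (Fin 2) K

/-- The field `K(x,y)` of rational functions in two variables. -/
abbrev Rat2 (K : Type*) [Field K] : Type _ := FractionRing (Poly2 K)

/-- The ambient field of generalized power series in a variable `u` with rational exponents.
The Puiseux series in `u = x⁻¹` are its elements that satisfy `IsPuiseux`. -/
abbrev Series (K : Type*) [Field K] : Type _ := HahnSeries ℚ K

section

variable {K : Type*} [Field K]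

/-- Numerator of a rational function in reduced form. -/
def num (r : Rat2 K) : Poly2 K := IsFractionRing.num (Poly2 K) r

/-- Denominator of a rational function in reduced form. -/
def den (r : Rat2 K) : Poly2 K := (IsFractionRing.den (Poly2 K) r : Poly2 K)

/-- The rational function `x`. -/
def X : Rat2 K := algebraMap (Poly2 K) (Rat2 K) (MvPolynomial.X 0)

/-- The rational function `y`. -/
def Y : Rat2 K := algebraMap (Poly2 K) (Rat2 K) (MvPolynomial.X 1)

/-- The substitution `r(a, b)` of elements `a`, `b` of an extension field of `K` into a rational
function `r ∈ K(x,y)`. It is meaningful when the denominator of `r` does not vanish at `(a, b)`. -/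
def subst {L : Type*} [Field L] [Algebra K L] (r : Rat2 K) (a b : L) : L :=
  MvPolynomial.aeval ![a, b] (num r) / MvPolynomial.aeval ![a, b] (den r)

/-- The rational function `f(x)` in `K(x,y)`, for `f` univariate. -/
def inX (f : RatFunc K) : Rat2 K := f.eval (algebraMap K (Rat2 K)) X

/-- The rational function `g(y)` in `K(x,y)`, for `g` univariate. -/
def inY (g : RatFunc K) : Rat2 K := g.eval (algebraMap K (Rat2 K)) Y

/-- The local ring `K[x,y]_p`: the rational functions whose reduced denominator is not divisible
by `p`. -/
def localRing (p : Poly2 K) : Set (Rat2 K) := {r | ¬ p ∣ den r}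

/-- The set `F(r,p)` of pairs `(f, g)` with `f(x) - g(y) = r + q p` for some `q ∈ K[x,y]_p`. -/
def F (r : Rat2 K) (p : Poly2 K) : Set (RatFunc K × RatFunc K) :=
  {fg | ∃ q ∈ localRing p, inX fg.1 - inY fg.2 = r + q * algebraMap (Poly2 K) (Rat2 K) p}

/-- The point `s` of the projective line `K ∪ {∞}` is a pole of the univariate rational
function `f`. -/
def IsPoleOf (f : RatFunc K) : OnePoint K → Prop
  | ∞ => f.denom.natDegree < f.num.natDegree
  | (s : K) => f.denom.IsRoot s

/-! ### The curve in `ℙ¹ × ℙ¹` and its orbits -/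

/-- Homogeneous coordinates `(x₀ : x₁)` of a point `x₁ / x₀` of the projective line. -/
def coords : OnePoint K → Fin 2 → K
  | ∞ => ![0, 1]
  | (s : K) => ![1, s]

/-- The value of the bi-homogenization `x₀ ^ deg_x p * y₀ ^ deg_y p * p (x₁ / x₀, y₁ / y₀)`. -/
def biHom (p : Poly2 K) (x y : Fin 2 → K) : K :=
  ∑ m ∈ p.support, p.coeff m *
    (x 0 ^ (p.degreeOf 0 - m 0) * x 1 ^ m 0) * (y 0 ^ (p.degreeOf 1 - m 1) * y 1 ^ m 1)

/-- The curve in `ℙ¹(K) × ℙ¹(K)` associated with the bi-homogenization of `p`. -/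
def curve (p : Poly2 K) : Set (OnePoint K × OnePoint K) :=
  {s | biHom p (coords s.1) (coords s.2) = 0}

/-- Two points of the curve share a common coordinate. -/
def ShareCoord {p : Poly2 K} (a b : curve p) : Prop :=
  a.1.1 = b.1.1 ∨ a.1.2 = b.1.2

/-- The orbit of a point: its class under the smallest equivalence relation on the curve that
relates any two points sharing a coordinate. -/
def orbit {p : Poly2 K} (s : curve p) : Set (curve p) :=
  {a | Relation.EqvGen ShareCoord s a}

/-- The graph of an orbit. -/
def orbitGraph {p : Poly2 K} (s : curve p) : SimpleGraph (orbit s) where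
  Adj a b := a ≠ b ∧ ShareCoord a.1 b.1
  symm := ⟨fun _ _ h => ⟨h.1.symm, h.2.imp Eq.symm Eq.symm⟩⟩
  loopless := ⟨fun _ h => h.1 rfl⟩

/-- An infinite path `v 0, v 1, …` in a graph. -/
def IsInfinitePath {V : Type*} (G : SimpleGraph V) (v : ℕ → V) : Prop :=
  ∀ i, G.Adj (v i) (v (i + 1))

/-- No finite section `v i, …, v (i + n)` with `n > 0` is a cycle, i.e. starts and ends at the
same vertex. -/
def CycleFree {V : Type*} (v : ℕ → V) : Prop :=
  ∀ i n, 0 < n → v i ≠ v (i + n)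

/-! ### Poles on the curve -/

/-- A generalized power series is a Puiseux series if its exponents have a common denominator. -/
def IsPuiseux (φ : Series K) : Prop :=
  ∃ n : ℕ, 0 < n ∧ ∀ a ∈ φ.support, ∃ k : ℤ, a = (k : ℚ) / n

/-- The element `x = u⁻¹` of the field of series in `u = x⁻¹`. -/
def xSeries : Series K := HahnSeries.single (-1) 1

/-- `(∞, ∞)` is a pole of `r` on the curve of `p`: there is a Puiseux series `φ` in `x⁻¹` with
`p(x, φ) = 0`, `deg φ > 0` and `deg r(x, φ) > 0`. The degree in `x` is the negative of the order
in `u = x⁻¹`. -/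
def IsPoleAtInfty (p : Poly2 K) (r : Rat2 K) : Prop :=
  ((∞, ∞) : OnePoint K × OnePoint K) ∈ curve p ∧
    ∃ φ : Series K, IsPuiseux φ ∧ MvPolynomial.aeval ![xSeries, φ] p = 0 ∧
      φ.orderTop < 0 ∧ (subst r xSeries φ).orderTop < 0

/-- The fractional linear expression `(a z + b) / (c z + d)` for `g = !![a, b; c, d]`. -/
def moebius {L : Type*} [Field L] [Algebra K L] (g : GL (Fin 2) K) (z : L) : L :=
  (algebraMap K L (g 0 0) * z + algebraMap K L (g 0 1)) /
    (algebraMap K L (g 1 0) * z + algebraMap K L (g 1 1))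

/-- The composition `r ∘ T⁻¹` with the inverse of the transformation
`T = (T₁, T₂)` of `ℙ¹(K) × ℙ¹(K)`. -/
def compInv (r : Rat2 K) (T₁ T₂ : GL (Fin 2) K) : Rat2 K :=
  subst r (moebius T₁⁻¹ X) (moebius T₂⁻¹ Y)

open Classical in
/-- The point `s` is a pole of `r` on the curve associated with `p`: some transformation
`T = (T₁, T₂)` of `ℙ¹(K) × ℙ¹(K)` maps `s` to `(∞, ∞)`, and the latter is a pole of `r ∘ T⁻¹` on
the curve associated with the numerator of `p ∘ T⁻¹`. -/
def IsPole (p : Poly2 K) (r : Rat2 K) (s : OnePoint K × OnePoint K) : Prop :=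
  ∃ T₁ T₂ : GL (Fin 2) K, T₁ • s.1 = ∞ ∧ T₂ • s.2 = ∞ ∧
    IsPoleAtInfty (num (compInv (algebraMap (Poly2 K) (Rat2 K) p) T₁ T₂)) (compInv r T₁ T₂)

end

end SepVar

end

noncomputable section

namespace SepVar

/-! ### Hensel's lemma and the Newton-Puiseux theorem -/

/-! At a point `(c₁, c₂)` of the curve that is not a pole of `r`, the function `f` has a pole at
`c₁` exactly when `g` has one at `c₂` (`isPoleOf_iff_isPoleOf`). To see this, take one Puiseux
branch `(a, b)` of the curve centred at the point. Since `p(a, b) = 0`, the multiple of `p` drops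
out and `f(a) - g(b) = r(a, b)`. The right side has nonnegative order, because otherwise this very
branch would make the point a pole of `r`. So `f(a)` and `g(b)` have negative order together or not
at all, and a pole of `f` or `g` is detected by that order (`isPoleOf_iff`).

Along the path, each vertex after `v 0` is such a point, and consecutive vertices share a
coordinate. If `f` had a pole at the first coordinate of `v 1`, then all later vertices would have
both coordinates among the finitely many poles of `f` and `g`, which is impossible for distinct
vertices (`not_of_propagates`). Hence neither coordinate of `v 1` is a pole, and `v 1` shares a
coordinate with `s`.

The algebra behind this is the existence of a branch at every point, including those at infinity
(`exists_parametrization`, from Newton-Puiseux in `exists_expand_root`), and the fact that rational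
functions in `K[x,y]_p` can be evaluated on it (`aeval_ne_zero_of_not_dvd`). -/

open Polynomial in
/-- Hensel's lemma for simple roots of polynomials that need not be monic. -/
theorem exists_root_of_isAdicComplete {R : Type*} [CommRing R] (I : Ideal R) [IsAdicComplete I R]
    (f : R[X]) (a w : R) (ha : f.eval a ∈ I) (hw : 1 - f.derivative.eval a * w ∈ I) :
    ∃ b, f.eval b = 0 ∧ b - a ∈ I := by
  -- Newton's iteration with the fixed approximate inverse `w` of `f'(a)`; each step gains one power
  -- of `I`.
  let c : ℕ → R := fun n => Nat.recOn n a fun _ b => b - w * f.eval b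
  have hc : ∀ n, c (n + 1) = c n - w * f.eval (c n) := fun n => rfl
  have key : ∀ n, c n - a ∈ I ∧ f.eval (c n) ∈ I ^ (n + 1) := by
    intro n
    induction n with
    | zero => simpa [c] using ha
    | succ n ih =>
      obtain ⟨h1, h2⟩ := ih
      have h2' : f.eval (c n) ∈ I := Ideal.pow_le_self (by omega) h2
      refine ⟨?_, ?_⟩
      · rw [hc, sub_right_comm]
        exact I.sub_mem h1 (I.mul_mem_left _ h2')
      · obtain ⟨k, hk⟩ := f.binomExpansion (c n) (-(w * f.eval (c n)))
        obtain ⟨d, hd⟩ := f.derivative.evalSubFactor (c n) a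
        have h3 : f.eval (c (n + 1)) = ((1 - f.derivative.eval a * w) - d * (c n - a) * w
            + k * w ^ 2 * f.eval (c n)) * f.eval (c n) := by
          rw [hc, sub_eq_add_neg, hk]
          linear_combination (- w * f.eval (c n)) * hd
        rw [h3, pow_succ']
        refine Ideal.mul_mem_mul (I.add_mem (I.sub_mem hw ?_) (I.mul_mem_left _ h2')) h2
        exact I.mul_mem_right _ (I.mul_mem_left _ h1)
  have cauchy : ∀ m n, m ≤ n → c m ≡ c n [SMOD (I ^ m • ⊤ : Ideal R)] := by
    intro m n hmn
    rw [← Ideal.one_eq_top, Ideal.smul_eq_mul, mul_one]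
    induction n, hmn using Nat.le_induction with
    | base => rfl
    | succ n hmn ih =>
      refine ih.trans ?_
      rw [SModEq.sub_mem, hc, sub_sub_cancel]
      exact Ideal.mul_mem_left _ _ (Ideal.pow_le_pow_right (by omega) (key n).2)
  obtain ⟨b, hb⟩ := IsPrecomplete.prec' c (cauchy _ _)
  refine ⟨b, ?_, ?_⟩
  · refine IsHausdorff.haus' (I := I) _ fun n => ?_
    have h := hb n
    rw [← Ideal.one_eq_top, Ideal.smul_eq_mul, mul_one] at h ⊢
    refine (h.symm.eval f).trans ?_
    rw [SModEq.zero]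
    exact Ideal.pow_le_pow_right (by omega) (key n).2
  · have h := hb 1
    rw [pow_one, ← Ideal.one_eq_top, Ideal.smul_eq_mul, mul_one, SModEq.sub_mem] at h
    have := I.sub_mem (key 1).1 h
    simpa using this

section Newton

variable {K : Type*} [Field K]

open Polynomial in
/-- A simple root `0` of the reduction of a polynomial over `K⟦t⟧` lifts. -/
theorem exists_root_powerSeries (f : (PowerSeries K)[X])
    (h0 : PowerSeries.constantCoeff (f.coeff 0) = 0)
    (h1 : PowerSeries.constantCoeff (f.coeff 1) ≠ 0) :
    ∃ w, f.eval w = 0 ∧ PowerSeries.constantCoeff w = 0 := by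
  have hmem : ∀ a : PowerSeries K,
      a ∈ Ideal.span {PowerSeries.X} ↔ PowerSeries.constantCoeff a = 0 := fun a => by
    rw [Ideal.mem_span_singleton, PowerSeries.X_dvd_iff]
  obtain ⟨b, hb, hb'⟩ := exists_root_of_isAdicComplete (Ideal.span {PowerSeries.X}) f 0
    (PowerSeries.C (PowerSeries.constantCoeff (f.coeff 1))⁻¹)
    (by rwa [hmem, ← coeff_zero_eq_eval_zero])
    (by
      rw [hmem, ← coeff_zero_eq_eval_zero, coeff_derivative]
      simp [h1])
  exact ⟨b, hb, by simpa [hmem] using hb'⟩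

open Polynomial in
theorem map_constantCoeff_taylor (f : (PowerSeries K)[X]) (w : PowerSeries K) (c : K)
    (hw : PowerSeries.constantCoeff w = c) (i : ℕ) :
    PowerSeries.constantCoeff ((taylor w f).coeff i) =
      (taylor c (f.map PowerSeries.constantCoeff)).coeff i := by
  rw [← hw, ← coeff_map]
  simp [taylor_apply, Polynomial.map_comp]

open Polynomial in
/-- Tschirnhaus transformation: translating by a power series without constant term, one removes
the coefficient before the first one that is a unit. -/
theorem exists_taylor_coeff_eq_zero [CharZero K] (f : (PowerSeries K)[X]) (m : ℕ)
    (hlow : ∀ i < m + 1, PowerSeries.constantCoeff (f.coeff i) = 0)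
    (hm : PowerSeries.constantCoeff (f.coeff (m + 1)) ≠ 0) :
    ∃ w, PowerSeries.constantCoeff w = 0 ∧ (taylor w f).coeff m = 0 := by
  -- Coefficient `m` of `taylor w f` is the Hasse derivative at `w`. The linear coefficient of that
  -- derivative is `m + 1` times a unit, hence a unit in characteristic zero.
  obtain ⟨w, hw, hw0⟩ := exists_root_powerSeries (hasseDeriv m f)
    (by simpa [hasseDeriv_coeff] using hlow m (by omega))
    (by
      rw [hasseDeriv_coeff, add_comm 1 m, map_mul, map_natCast]
      exact mul_ne_zero (by simpa using Nat.cast_add_one_ne_zero m) hm)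
  exact ⟨w, hw0, by rw [taylor_coeff, hw]⟩

open Polynomial in
/-- A polynomial with a vanishing second highest coefficient that is not a monomial has a root
whose multiplicity is less than the degree. -/
theorem exists_taylor_coeff_ne_zero [IsAlgClosed K] [CharZero K] (h : K[X]) (m i : ℕ)
    (hdeg : h.natDegree = m + 1) (hm : h.coeff m = 0) (hi : i < m + 1) (hi0 : h.coeff i ≠ 0) :
    ∃ c : K, ∃ k, 0 < k ∧ k < m + 1 ∧ (∀ j < k, (taylor c h).coeff j = 0) ∧
      (taylor c h).coeff k ≠ 0 := by
  classical
  have hlead : h.coeff (m + 1) ≠ 0 := by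
    rw [← hdeg, coeff_natDegree, ne_eq, leadingCoeff_eq_zero]
    rintro rfl
    simp at hi0
  obtain ⟨c, hc⟩ := IsAlgClosed.exists_root h (by
    intro hd
    have := natDegree_eq_of_degree_eq_some hd
    rw [hdeg] at this
    exact absurd this (Nat.succ_ne_zero m))
  have htop : (taylor c h).coeff (m + 1) ≠ 0 := by
    rw [← hdeg, coeff_taylor_natDegree, ← coeff_natDegree, hdeg]
    exact hlead
  have hex : ∃ k, (taylor c h).coeff k ≠ 0 := ⟨_, htop⟩
  refine ⟨c, Nat.find hex, ?_, ?_, fun j hj => not_not.1 (Nat.find_min hex hj), Nat.find_spec hex⟩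
  · rw [Nat.find_pos, taylor_coeff_zero]
    simpa using hc
  · refine lt_of_le_of_ne (Nat.find_min' hex htop) fun heq => ?_
    have hz : ∀ j < m + 1, (taylor c h).coeff j = 0 := fun j hj =>
      not_not.1 (Nat.find_min hex (by omega))
    have h2 := hz m (by omega)
    -- If `c` had full multiplicity, this linear form would vanish at `c`. Then `c = 0` and `h`
    -- would be a monomial.
    have h3 : hasseDeriv m h = C (((m + 1 : ℕ) : K) * h.coeff (m + 1)) * Polynomial.X := by
      ext j
      rw [hasseDeriv_coeff, coeff_C_mul, coeff_X]
      rcases j with _ | _ | j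
      · simp [hm]
      · simp [add_comm]
      · rw [coeff_eq_zero_of_natDegree_lt (by omega)]
        simp
    rw [taylor_coeff, h3] at h2
    have hc0 : c = 0 := by
      simpa [hlead, Nat.cast_add_one_ne_zero] using h2
    have := hz i hi
    rw [hc0, taylor_zero] at this
    exact hi0 this

/-- The index `i` minimizes `ord (a i) / (m + 1 - i)`, so it marks the edge of the Newton polygon
ending at `(m + 1, 0)`. Its slope is `s / N` with `s = ord (a i)` and `N = m + 1 - i`; the fraction
need not be reduced. Minimality says `N * ord (a j) + s * j ≥ s * (m + 1)`, which is the final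
divisibility. -/
theorem exists_newton_slope (a : ℕ → PowerSeries K) (m : ℕ)
    (hlow : ∀ i < m + 1, PowerSeries.constantCoeff (a i) = 0) (h0 : a 0 ≠ 0) :
    ∃ i s N : ℕ, ∃ e : PowerSeries K, i + N = m + 1 ∧ 0 < s ∧ ∃ hN : N ≠ 0,
      PowerSeries.constantCoeff e ≠ 0 ∧ a i = PowerSeries.X ^ s * e ∧
      ∀ j < m + 1, PowerSeries.X ^ (s * (m + 1)) ∣
        PowerSeries.expand N hN (a j) * PowerSeries.X ^ (s * j) := by
  classical
  obtain ⟨i, hi, hmin⟩ := Finset.exists_min_image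
    ((Finset.range (m + 1)).filter fun i => a i ≠ 0)
    (fun i => ((a i).order.toNat : ℚ) / ((m + 1 : ℕ) - (i : ℚ))) ⟨0, by simp [h0]⟩
  simp only [Finset.mem_filter, Finset.mem_range, and_imp] at hi hmin
  obtain ⟨him, hi0⟩ := hi
  have hN : m + 1 - i ≠ 0 := by omega
  have hfac := PowerSeries.X_pow_order_mul_divXPowOrder (f := a i)
  have he : PowerSeries.constantCoeff (PowerSeries.divXPowOrder (a i)) ≠ 0 := by
    rwa [ne_eq, PowerSeries.constantCoeff_divXPowOrder_eq_zero_iff]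
  refine ⟨i, (a i).order.toNat, m + 1 - i, _, by omega, ?_, hN, he, hfac.symm, ?_⟩
  · refine Nat.pos_of_ne_zero fun hz => he ?_
    rw [hz, pow_zero, one_mul] at hfac
    rw [hfac]
    exact hlow i him
  · intro j hj
    by_cases hj0 : a j = 0
    · simp [hj0]
    have hle := hmin j hj hj0
    have hp1 : (0 : ℚ) < (m + 1 : ℕ) - (i : ℚ) := by
      rw [sub_pos]; exact_mod_cast him
    have hp2 : (0 : ℚ) < (m + 1 : ℕ) - (j : ℚ) := by
      rw [sub_pos]; exact_mod_cast hj
    rw [div_le_div_iff₀ hp1 hp2, ← Nat.cast_sub him.le, ← Nat.cast_sub hj.le] at hle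
    have hle' : (a i).order.toNat * (m + 1 - j) ≤ (a j).order.toNat * (m + 1 - i) := by
      exact_mod_cast hle
    have hsplit : (a i).order.toNat * (m + 1) =
        (a i).order.toNat * (m + 1 - j) + (a i).order.toNat * j := by
      rw [← mul_add, Nat.sub_add_cancel hj.le]
    rw [hsplit, pow_add]
    refine mul_dvd_mul (dvd_trans (pow_dvd_pow _ hle') ?_) dvd_rfl
    rw [← PowerSeries.X_pow_order_mul_divXPowOrder (f := a j), map_mul, map_pow,
      PowerSeries.expand_X, ← pow_mul, mul_comm (m + 1 - i)]
    simp only [PowerSeries.X_pow_order_mul_divXPowOrder]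
    exact dvd_mul_right _ _

/-- The substitution `t ↦ t ^ N` in power series, as a ring homomorphism. -/
abbrev expandHom (N : ℕ) (hN : N ≠ 0) : PowerSeries K →+* PowerSeries K :=
  (PowerSeries.expand N hN : PowerSeries K →ₐ[K] PowerSeries K)

open Polynomial in
/-- **Newton-Puiseux theorem**, local form: a polynomial over `K⟦t⟧` whose reduction is nonzero and
has the root `0` acquires a root without constant term after adjoining a root of `t`. -/
theorem exists_expand_root [IsAlgClosed K] [CharZero K] (m : ℕ) :
    ∀ f : (PowerSeries K)[X], (∀ i < m + 1, PowerSeries.constantCoeff (f.coeff i) = 0) →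
      PowerSeries.constantCoeff (f.coeff (m + 1)) ≠ 0 →
      ∃ (N : ℕ) (hN : N ≠ 0) (w : PowerSeries K), PowerSeries.constantCoeff w = 0 ∧
        (f.map (expandHom N hN)).eval w = 0 := by
  induction m using Nat.strong_induction_on with
  | _ m ih =>
  intro f hlow hm
  obtain ⟨w, hw, hwm⟩ := exists_taylor_coeff_eq_zero f m hlow hm
  -- The translation by `w` commutes with `t ↦ t ^ N` up to expanding `w`, so coefficient `m` may be
  -- assumed zero.
  suffices H : ∀ f : (PowerSeries K)[X], f.coeff m = 0 →
      (∀ i < m + 1, PowerSeries.constantCoeff (f.coeff i) = 0) →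
      PowerSeries.constantCoeff (f.coeff (m + 1)) ≠ 0 →
      ∃ (N : ℕ) (hN : N ≠ 0) (w : PowerSeries K), PowerSeries.constantCoeff w = 0 ∧
        (f.map (expandHom N hN)).eval w = 0 by
    have hco := fun i => map_constantCoeff_taylor f w 0 hw i
    simp only [taylor_zero, coeff_map] at hco
    obtain ⟨N, hN, z, hz, hroot⟩ := H (taylor w f) hwm (fun i hi => by rw [hco, hlow i hi])
      (by rwa [hco])
    refine ⟨N, hN, z + PowerSeries.expand N hN w, ?_, ?_⟩
    · simp [hz, hw]
    · rw [← taylor_eval, ← hroot]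
      simp [taylor_apply, Polynomial.map_comp]
  clear! f w
  intro f hfm hlow hm
  by_cases h0 : f.coeff 0 = 0
  · exact ⟨1, one_ne_zero, 0, by simp, by rw [← coeff_zero_eq_eval_zero, coeff_map, h0, map_zero]⟩
  obtain ⟨i, s, N, e, hiN, hs, hN, he, hfi, hdvd⟩ := exists_newton_slope f.coeff m hlow h0
  let E : PowerSeries K →+* PowerSeries K := expandHom N hN
  have hEc : ∀ a, PowerSeries.constantCoeff (E a) = PowerSeries.constantCoeff a := fun a => by
    simp [E]
  have hEX : E PowerSeries.X = PowerSeries.X ^ N := PowerSeries.expand_X N hN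
  -- Substitute `t ↦ t ^ N`, `Y ↦ t ^ s * Y` and divide by `t ^ (s * (m + 1))`.
  obtain ⟨h, hh⟩ : C (PowerSeries.X ^ (s * (m + 1))) ∣
      (f.map E).comp (C (PowerSeries.X ^ s) * Polynomial.X) := by
    rw [C_dvd_iff_dvd_coeff]
    intro j
    rw [comp_C_mul_X_coeff, coeff_map, ← pow_mul]
    rcases lt_or_ge j (m + 1) with hj | hj
    · exact hdvd j hj
    · exact Dvd.dvd.mul_left (pow_dvd_pow _ (Nat.mul_le_mul_left s hj)) _
  have hcoeff : ∀ j, E (f.coeff j) * PowerSeries.X ^ (s * j) =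
      PowerSeries.X ^ (s * (m + 1)) * h.coeff j := fun j => by
    rw [← coeff_C_mul, ← hh, comp_C_mul_X_coeff, coeff_map, ← pow_mul]
  have hXne : ∀ n, (PowerSeries.X : PowerSeries K) ^ n ≠ 0 := fun n =>
    pow_ne_zero _ PowerSeries.X_ne_zero
  have hge : ∀ j, h.coeff (m + 1 + j) = E (f.coeff (m + 1 + j)) * PowerSeries.X ^ (s * j) :=
    fun j => mul_left_cancel₀ (hXne (s * (m + 1))) (by rw [← hcoeff]; ring)
  have hi : h.coeff i = E e := mul_left_cancel₀ (hXne (s * (m + 1))) (by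
    rw [← hcoeff, hfi, map_mul, map_pow, hEX, ← hiN]; ring)
  have hm' : h.coeff m = 0 := mul_left_cancel₀ (hXne (s * (m + 1))) (by
    rw [← hcoeff, hfm]; simp)
  have htop : PowerSeries.constantCoeff (h.coeff (m + 1)) ≠ 0 := by
    have := hge 0
    rw [add_zero] at this
    rw [this]
    simpa [hEc] using hm
  -- The reduction of `h` has degree `m + 1`, no term of degree `m`, and a nonzero term of degree `i
  -- < m + 1`. It thus has a root of smaller multiplicity, where the induction hypothesis applies.
  obtain ⟨c, k, hk, hkm, hckj, hckk⟩ := exists_taylor_coeff_ne_zero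
    (h.map PowerSeries.constantCoeff) m i
    (by
      refine natDegree_eq_of_le_of_coeff_ne_zero ?_ (by rwa [coeff_map])
      refine natDegree_le_iff_coeff_eq_zero.2 fun j hj => ?_
      obtain ⟨l, rfl⟩ := Nat.exists_eq_add_of_lt hj
      rw [coeff_map, add_assoc, hge]
      simp [hs.ne'])
    (by rw [coeff_map, hm', map_zero]) (by omega) (by rwa [coeff_map, hi, hEc])
  obtain ⟨l, rfl⟩ : ∃ l, k = l + 1 := ⟨k - 1, by omega⟩
  have hco := fun i => map_constantCoeff_taylor h (PowerSeries.C c) c (by simp) i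
  obtain ⟨N', hN', z, hz, hroot⟩ := ih l (by omega) (taylor (PowerSeries.C c) h)
    (fun i hi => by rw [hco, hckj i hi]) (by rwa [hco])
  let E' : PowerSeries K →+* PowerSeries K := expandHom N' hN'
  have hE'X : E' PowerSeries.X = PowerSeries.X ^ N' := PowerSeries.expand_X N' hN'
  have hroot' : (h.map E').eval (z + PowerSeries.C c) = 0 := by
    rw [← taylor_eval, ← hroot]
    simp [taylor_apply, Polynomial.map_comp, E', PowerSeries.expand_C]
  refine ⟨N' * N, mul_ne_zero hN' hN, PowerSeries.X ^ (N' * s) * (z + PowerSeries.C c), ?_, ?_⟩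
  · simp [hN', hs.ne']
  · have hcomp : expandHom (K := K) (N' * N) (mul_ne_zero hN' hN) = E'.comp E := by
      simp only [E, E', expandHom, PowerSeries.expand_mul_eq_comp N' hN' N hN]
      rfl
    rw [hcomp, ← Polynomial.map_map]
    have h2 := congrArg (fun q => (q.map E').eval (z + PowerSeries.C c)) hh
    simp only [Polynomial.map_comp, Polynomial.map_mul, map_X, eval_comp, eval_mul, eval_X,
      hroot', mul_zero, map_C, eval_C] at h2
    rwa [map_pow, hE'X, ← pow_mul] at h2

end Newton

/-! ### Fractional power series roots -/

section Ramified

variable {K : Type*} [Field K]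

theorem algebraMap_series (a : K) : algebraMap K (Series K) a = HahnSeries.C a := by
  rw [HahnSeries.algebraMap_apply', PowerSeries.algebraMap_apply]
  exact HahnSeries.ofPowerSeries_C a

/-- Laurent series in `t`, read as series in `u = t ^ N`. -/
def ramified (N : ℕ) (hN : 0 < N) : HahnSeries ℤ K →+* Series K :=
  HahnSeries.embDomainRingHom
    { toFun := fun k : ℤ => (k : ℚ) / N
      map_zero' := by simp
      map_add' := fun a b => by push_cast; ring }
    (fun a b h => by
      have hN' : (N : ℚ) ≠ 0 := by positivity
      simpa [div_left_inj' hN'] using h)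
    (fun a b => by
      have hN' : (0 : ℚ) < N := by positivity
      simp [div_le_div_iff_of_pos_right hN'])

theorem isPuiseux_ramified (N : ℕ) (hN : 0 < N) (a : HahnSeries ℤ K) :
    IsPuiseux (ramified N hN a) := by
  refine ⟨N, hN, fun q hq => ?_⟩
  obtain ⟨k, -, hk⟩ := HahnSeries.support_embDomain_subset hq
  exact ⟨k, hk.symm⟩

theorem ramified_single (N : ℕ) (hN : 0 < N) (k : ℤ) (c : K) :
    ramified N hN (HahnSeries.single k c) = HahnSeries.single ((k : ℚ) / N) c :=
  HahnSeries.embDomain_single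

theorem orderTop_ramified_pos (N : ℕ) (hN : 0 < N) (w : PowerSeries K)
    (hw : PowerSeries.constantCoeff w = 0) :
    0 < (ramified N hN (HahnSeries.ofPowerSeries ℤ K w)).orderTop := by
  set a := ramified N hN (HahnSeries.ofPowerSeries ℤ K w) with ha
  by_contra! hle
  have hne : a ≠ 0 := by
    intro h
    simp [h] at hle
  have hmem : a.order ∈ a.support := HahnSeries.coeff_order_eq_zero.not.2 hne
  obtain ⟨k, hk, hk'⟩ := HahnSeries.support_embDomain_subset hmem
  obtain ⟨n, hn, rfl⟩ := HahnSeries.support_embDomain_subset hk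
  have hn0 : n ≠ 0 := by
    rintro rfl
    refine hn ?_
    exact HahnSeries.coeff_toPowerSeries_symm.trans
      ((PowerSeries.coeff_zero_eq_constantCoeff_apply w).trans hw)
  rw [← HahnSeries.order_eq_orderTop_of_ne_zero hne, ← hk'] at hle
  have hle' : ((n : ℤ) : ℚ) / N ≤ 0 := WithTop.coe_le_coe.1 hle
  have : 0 < ((n : ℤ) : ℚ) / N := by positivity
  exact absurd hle' this.not_ge

-- The multiplicity of the root `0` at `t = 0` is finite because the reduction is nonzero, so
-- Newton-Puiseux applies. Reading `t` as `u ^ (1 / N)` turns the expanded coefficients back into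
-- the original ones at `u`. The inverse of `ψ` is the branch at infinity that the definition of a
-- pole asks for.
open Polynomial in
theorem exists_series_root [IsAlgClosed K] [CharZero K] (h : K[X][X])
    (h0 : (h.coeff 0).eval 0 = 0) (hne : h.map (evalRingHom 0) ≠ 0) :
    ∃ ψ : Series K, IsPuiseux ψ⁻¹ ∧ 0 < ψ.orderTop ∧
      h.eval₂ (aeval (HahnSeries.single 1 1 : Series K) : K[X] →ₐ[K] Series K) ψ = 0 := by
  classical
  have hex : ∃ k, (h.map (evalRingHom 0)).coeff k ≠ 0 := by
    by_contra! hall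
    exact hne (Polynomial.ext (by simpa using hall))
  have hpos : 0 < Nat.find hex := by
    rw [Nat.find_pos]
    simpa using h0
  obtain ⟨m, hm⟩ := Nat.exists_eq_add_of_lt hpos
  rw [zero_add] at hm
  have hconst : ∀ q : K[X], PowerSeries.constantCoeff (q : PowerSeries K) = q.eval 0 := fun q => by
    rw [← PowerSeries.coeff_zero_eq_constantCoeff, coeff_coe, coeff_zero_eq_eval_zero]
  obtain ⟨N, hN, w, hw, hroot⟩ := exists_expand_root m
    (h.map (coeToPowerSeries.ringHom : K[X] →+* PowerSeries K))
    (fun i hi => by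
      have := Nat.find_min hex (hm ▸ hi)
      simpa [hconst] using this)
    (by
      have := Nat.find_spec hex
      rw [hm] at this
      simpa [hconst] using this)
  have hN' := Nat.pos_of_ne_zero hN
  refine ⟨ramified N hN' (HahnSeries.ofPowerSeries ℤ K w), ?_, orderTop_ramified_pos N hN' w hw, ?_⟩
  · rw [← map_inv₀]
    exact isPuiseux_ramified _ _ _
  · have h2 := congrArg ((ramified N hN').comp (HahnSeries.ofPowerSeries ℤ K)) hroot
    rw [map_zero, Polynomial.map_map, eval_map, hom_eval₂] at h2
    convert h2 using 2; swap; · rfl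
    refine Polynomial.ringHom_ext (fun a => ?_) ?_
    · simp only [RingHom.coe_coe, aeval_C, RingHom.comp_apply, coeToPowerSeries.ringHom_apply,
        coe_C, expandHom, PowerSeries.expand_C, HahnSeries.ofPowerSeries_C]
      rw [HahnSeries.C_apply, ramified_single, Int.cast_zero, zero_div]
      exact algebraMap_series a
    · simp only [RingHom.coe_coe, aeval_X, RingHom.comp_apply, coeToPowerSeries.ringHom_apply,
        coe_X, expandHom, PowerSeries.expand_X, HahnSeries.ofPowerSeries_X_pow]
      rw [ramified_single, Int.cast_natCast, div_self (by exact_mod_cast hN)]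

end Ramified

/-! ### Values of rational functions in an extension field -/

section Value

variable {K : Type*} [Field K] {L : Type*} [Field L] [Algebra K L]

/-- The value of the rational function `ρ` at `(a, b)` is defined and equal to `t`. -/
def IsValue (a b : L) (ρ : Rat2 K) (t : L) : Prop :=
  ∃ P Q : Poly2 K, MvPolynomial.aeval ![a, b] Q ≠ 0 ∧
    ρ * algebraMap (Poly2 K) (Rat2 K) Q = algebraMap (Poly2 K) (Rat2 K) P ∧
    t * MvPolynomial.aeval ![a, b] Q = MvPolynomial.aeval ![a, b] P

theorem isValue_algebraMap (a b : L) (P : Poly2 K) :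
    IsValue a b (algebraMap (Poly2 K) (Rat2 K) P) (MvPolynomial.aeval ![a, b] P) :=
  ⟨P, 1, by simp, by simp, by simp⟩

theorem isValue_const (a b : L) (c : K) :
    IsValue a b (algebraMap K (Rat2 K) c) (algebraMap K L c) := by
  have := isValue_algebraMap a b (MvPolynomial.C c : Poly2 K)
  rwa [MvPolynomial.aeval_C, ← MvPolynomial.algebraMap_eq,
    ← IsScalarTower.algebraMap_apply] at this

theorem isValue_X (a b : L) : IsValue a b (X : Rat2 K) a := by
  simpa [X] using isValue_algebraMap a b (MvPolynomial.X 0 : Poly2 K)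

theorem isValue_Y (a b : L) : IsValue a b (Y : Rat2 K) b := by
  simpa [Y] using isValue_algebraMap a b (MvPolynomial.X 1 : Poly2 K)

namespace IsValue

variable {a b : L} {ρ σ : Rat2 K} {t s : L}

theorem add (h : IsValue a b ρ t) (h' : IsValue a b σ s) : IsValue a b (ρ + σ) (t + s) := by
  obtain ⟨P, Q, hQ, h1, h2⟩ := h
  obtain ⟨P', Q', hQ', h1', h2'⟩ := h'
  refine ⟨P * Q' + P' * Q, Q * Q', by simp [hQ, hQ'], ?_, ?_⟩
  · simp only [map_mul, map_add, ← h1, ← h1']; ring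
  · simp only [map_mul, map_add, ← h2, ← h2']; ring

theorem mul (h : IsValue a b ρ t) (h' : IsValue a b σ s) : IsValue a b (ρ * σ) (t * s) := by
  obtain ⟨P, Q, hQ, h1, h2⟩ := h
  obtain ⟨P', Q', hQ', h1', h2'⟩ := h'
  refine ⟨P * P', Q * Q', by simp [hQ, hQ'], ?_, ?_⟩
  · simp only [map_mul, ← h1, ← h1']; ring
  · simp only [map_mul, ← h2, ← h2']; ring

theorem sub (h : IsValue a b ρ t) (h' : IsValue a b σ s) : IsValue a b (ρ - σ) (t - s) := by
  have := h.add ((isValue_const a b (-1 : K)).mul h')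
  simpa [sub_eq_add_neg] using this

theorem inv (h : IsValue a b ρ t) (ht : t ≠ 0) : IsValue a b ρ⁻¹ t⁻¹ := by
  obtain ⟨P, Q, hQ, h1, h2⟩ := h
  have hP : MvPolynomial.aeval ![a, b] P ≠ 0 := h2 ▸ mul_ne_zero ht hQ
  have hρ : ρ ≠ 0 := by
    rintro rfl
    rw [zero_mul, eq_comm, map_eq_zero_iff _ (IsFractionRing.injective _ _)] at h1
    simp [h1] at hP
  exact ⟨Q, P, hP, by rw [← h1, inv_mul_cancel_left₀ hρ], by rw [← h2, inv_mul_cancel_left₀ ht]⟩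

theorem div (h : IsValue a b ρ t) (h' : IsValue a b σ s) (hs : s ≠ 0) :
    IsValue a b (ρ / σ) (t / s) := by
  rw [div_eq_mul_inv, div_eq_mul_inv]
  exact h.mul (h'.inv hs)

theorem mvPolynomial_aeval {A B : Rat2 K} (hA : IsValue a b A t) (hB : IsValue a b B s)
    (n : Poly2 K) :
    IsValue a b (MvPolynomial.aeval ![A, B] n) (MvPolynomial.aeval ![t, s] n) := by
  induction n using MvPolynomial.induction_on with
  | C c => simpa using isValue_const a b c
  | add p q hp hq => simpa using hp.add hq
  | mul_X p i hp =>
    rw [map_mul, map_mul]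
    refine hp.mul ?_
    fin_cases i <;> simpa

theorem polynomial_aeval {A : Rat2 K} (hA : IsValue a b A t) (n : Polynomial K) :
    IsValue a b (n.eval₂ (algebraMap K (Rat2 K)) A) (Polynomial.aeval t n) := by
  induction n using Polynomial.induction_on' with
  | add p q hp hq => simpa [Polynomial.eval₂_add] using hp.add hq
  | monomial k c =>
    rw [Polynomial.eval₂_monomial, Polynomial.aeval_monomial]
    refine (isValue_const a b c).mul ?_
    induction k with
    | zero => simpa using isValue_const a b (1 : K)
    | succ k ih => simpa [pow_succ] using ih.mul hA

theorem ratFunc_eval {A : Rat2 K} (hA : IsValue a b A t) (f : RatFunc K)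
    (hf : Polynomial.aeval t f.denom ≠ 0) :
    IsValue a b (f.eval (algebraMap K (Rat2 K)) A)
      (Polynomial.aeval t f.num / Polynomial.aeval t f.denom) :=
  (hA.polynomial_aeval _).div (hA.polynomial_aeval _) hf

theorem moebius {A : Rat2 K} (hA : IsValue a b A t) (g : GL (Fin 2) K)
    (h : algebraMap K L (g 1 0) * t + algebraMap K L (g 1 1) ≠ 0) :
    IsValue a b (moebius g A) (SepVar.moebius g t) :=
  (((isValue_const a b _).mul hA).add (isValue_const a b _)).div
    (((isValue_const a b _).mul hA).add (isValue_const a b _)) h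

theorem mul_den (ρ : Rat2 K) : ρ * algebraMap (Poly2 K) (Rat2 K) (den ρ) =
    algebraMap (Poly2 K) (Rat2 K) (num ρ) := by
  rw [← eq_div_iff]
  · exact (IsFractionRing.mk'_num_den' (Poly2 K) ρ).symm
  · exact IsFractionRing.to_map_ne_zero_of_mem_nonZeroDivisors (IsFractionRing.den (Poly2 K) ρ).2

/-- The reduced denominator divides every other denominator, being coprime to the reduced numerator.
Hence `subst` may be computed from any fraction, which makes it compatible with field operations. -/
theorem den_ne_zero (h : IsValue a b ρ t) : MvPolynomial.aeval ![a, b] (den ρ) ≠ 0 := by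
  obtain ⟨P, Q, hQ, h1, h2⟩ := h
  have h3 : num ρ * Q = P * den ρ := by
    apply IsFractionRing.injective (Poly2 K) (Rat2 K)
    rw [map_mul, map_mul, ← h1, ← mul_den]
    ring
  have hrel : IsRelPrime (den ρ) (num ρ) := (IsFractionRing.num_den_reduced (Poly2 K) ρ).symm
  obtain ⟨c, hc⟩ : den ρ ∣ Q := hrel.dvd_of_dvd_mul_left ⟨P, by rw [h3, mul_comm]⟩
  intro h0
  rw [hc, map_mul, h0, zero_mul] at hQ
  exact hQ rfl

theorem subst_eq (h : IsValue a b ρ t) : subst ρ a b = t := by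
  have hd := h.den_ne_zero
  obtain ⟨P, Q, hQ, h1, h2⟩ := h
  have h3 : num ρ * Q = P * den ρ := by
    apply IsFractionRing.injective (Poly2 K) (Rat2 K)
    rw [map_mul, map_mul, ← h1, ← mul_den]
    ring
  rw [subst, div_eq_iff hd]
  have h4 := congrArg (MvPolynomial.aeval ![a, b]) h3
  rw [map_mul, map_mul, ← h2] at h4
  exact mul_right_cancel₀ hQ (by rw [h4]; ring)

end IsValue

theorem isValue_subst {a b : L} {ρ : Rat2 K} (h : MvPolynomial.aeval ![a, b] (den ρ) ≠ 0) :
    IsValue a b ρ (subst ρ a b) :=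
  ⟨num ρ, den ρ, h, IsValue.mul_den ρ, div_mul_cancel₀ _ h⟩

/-- The composition with a fractional linear transformation takes the expected values. -/
theorem isValue_compInv {a b : L} {ρ : Rat2 K} (T₁ T₂ : GL (Fin 2) K)
    (h₁ : algebraMap K L (T₁⁻¹ 1 0) * a + algebraMap K L (T₁⁻¹ 1 1) ≠ 0)
    (h₂ : algebraMap K L (T₂⁻¹ 1 0) * b + algebraMap K L (T₂⁻¹ 1 1) ≠ 0)
    (h : MvPolynomial.aeval ![moebius T₁⁻¹ a, moebius T₂⁻¹ b] (den ρ) ≠ 0) :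
    IsValue a b (compInv ρ T₁ T₂) (subst ρ (moebius T₁⁻¹ a) (moebius T₂⁻¹ b)) :=
  have hA := (isValue_X (K := K) a b).moebius T₁⁻¹ h₁
  have hB := (isValue_Y (K := K) a b).moebius T₂⁻¹ h₂
  (hA.mvPolynomial_aeval hB _).div (hA.mvPolynomial_aeval hB _) h

end Value

/-! ### Generic points of an irreducible plane curve -/

section Kernel

variable {K : Type*} [Field K] {L : Type*} [Field L] [Algebra K L]

/-- By Gauss's lemma `p` stays irreducible in `K(y)[x]` and is coprime to `d` there. Evaluation
extends to `K(y)` because `v 1` is transcendental, so a common zero would turn the Bézout identity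
into `0 = 1`. -/
theorem aeval_ne_zero_of_not_dvd_zero {p d : Poly2 K} (hp : Irreducible p)
    (hdeg : 0 < p.degreeOf 0) {v : Fin 2 → L} (hv : Transcendental K (v 1))
    (hpv : MvPolynomial.aeval v p = 0) (hd : ¬ p ∣ d) : MvPolynomial.aeval v d ≠ 0 := by
  intro hdv
  let R := MvPolynomial (Fin 1) K
  let e := MvPolynomial.finSuccEquiv K 1
  let ev : R →ₐ[K] L := MvPolynomial.aeval fun _ => v 1
  have hev : Function.Injective ev := by
    have h1 := (algebraicIndependent_unique_type_iff (ι := Fin 1) (R := K)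
      (x := fun _ => v 1)).2 hv
    exact h1
  let φ : FractionRing R →+* L := IsFractionRing.lift (g := (ev : R →+* L)) hev
  have hφC : ∀ z : R, φ (algebraMap R (FractionRing R) z) = ev z :=
    fun z => IsFractionRing.lift_algebraMap hev z
  have hφ : ∀ q : Poly2 K, MvPolynomial.aeval v q =
      ((e q).map (algebraMap R (FractionRing R))).eval₂ φ (v 0) := by
    intro q
    induction q using MvPolynomial.induction_on with
    | C c =>
      have : e (MvPolynomial.C c) = Polynomial.C (MvPolynomial.C c) := e.commutes c
      rw [this, Polynomial.map_C, Polynomial.eval₂_C, hφC, MvPolynomial.aeval_C,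
        MvPolynomial.aeval_C]
    | add p q hp hq => simp only [map_add, Polynomial.map_add, Polynomial.eval₂_add, hp, hq]
    | mul_X p i hp =>
      simp only [map_mul, Polynomial.map_mul, Polynomial.eval₂_mul, hp]
      congr 1
      fin_cases i
      · simp [e, MvPolynomial.finSuccEquiv_X_zero]
      · have : (1 : Fin 2) = Fin.succ 0 := rfl
        simp only [Fin.mk_one, this, e, MvPolynomial.finSuccEquiv_X_succ]
        rw [Polynomial.map_C, Polynomial.eval₂_C, hφC, MvPolynomial.aeval_X, MvPolynomial.aeval_X]
        rfl
  have hirr : Irreducible (e p) := (MulEquiv.irreducible_iff e).2 hp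
  have hnat : (e p).natDegree ≠ 0 := by
    rw [MvPolynomial.natDegree_finSuccEquiv]; exact hdeg.ne'
  have hprim : (e p).IsPrimitive := hirr.isPrimitive hnat
  have hirr' := (hprim.irreducible_iff_irreducible_map_fraction_map (K := FractionRing R)).1 hirr
  have hnd : ¬ (e p).map (algebraMap R (FractionRing R)) ∣
      (e d).map (algebraMap R (FractionRing R)) := by
    rw [← hprim.dvd_iff_fraction_map_dvd_fraction_map (FractionRing R), map_dvd_iff]
    exact hd
  obtain ⟨s, t, hst⟩ := hirr'.coprime_iff_not_dvd.2 hnd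
  have := congrArg (Polynomial.eval₂ φ (v 0)) hst
  rw [Polynomial.eval₂_add, Polynomial.eval₂_mul, Polynomial.eval₂_mul, ← hφ, ← hφ, hpv, hdv] at this
  simp at this

/-- At a generic point of an irreducible curve only the multiples of the equation vanish. -/
theorem aeval_ne_zero_of_not_dvd {p d : Poly2 K} (hp : Irreducible p) {i j : Fin 2} (hij : i ≠ j)
    (hdeg : 0 < p.degreeOf i) {v : Fin 2 → L} (hv : Transcendental K (v j))
    (hpv : MvPolynomial.aeval v p = 0) (hd : ¬ p ∣ d) : MvPolynomial.aeval v d ≠ 0 := by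
  let τ : Fin 2 ≃ Fin 2 := Equiv.swap 0 i
  let e := MvPolynomial.renameEquiv K τ
  have hj : τ 1 = j := by
    revert hij; fin_cases i <;> fin_cases j <;> simp [τ]
  have hi : τ i = 0 := by simp [τ]
  have hinv : ∀ k, τ (τ k) = k := fun k => by simp [τ]
  have hval : ∀ q : Poly2 K, MvPolynomial.aeval (v ∘ τ) (e q) = MvPolynomial.aeval v q := by
    intro q
    rw [MvPolynomial.renameEquiv_apply, MvPolynomial.aeval_rename]
    congr 2
    ext k
    simp [hinv]
  rw [← hval]
  refine aeval_ne_zero_of_not_dvd_zero (p := e p) ((MulEquiv.irreducible_iff e).2 hp) ?_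
    (by simpa [hj] using hv) (by rw [hval, hpv]) (by rwa [map_dvd_iff])
  rw [MvPolynomial.renameEquiv_apply, ← hi, MvPolynomial.degreeOf_rename_of_injective τ.injective]
  exact hdeg

end Kernel

/-! ### Local coordinates on the projective line -/

section Local

variable {K : Type*} [Field K]

theorem orderTop_algebraMap {c : K} (hc : c ≠ 0) :
    (algebraMap K (Series K) c).orderTop = 0 := by
  rw [algebraMap_series, HahnSeries.C_apply, HahnSeries.orderTop_single hc]
  rfl

theorem orderTop_algebraMap_nonneg (c : K) : 0 ≤ (algebraMap K (Series K) c).orderTop := by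
  by_cases hc : c = 0
  · simp [hc]
  · exact (orderTop_algebraMap hc).ge

theorem orderTop_add_nonneg {a b : Series K} (ha : 0 ≤ a.orderTop) (hb : 0 ≤ b.orderTop) :
    0 ≤ (a + b).orderTop :=
  (le_min ha hb).trans HahnSeries.min_orderTop_le_orderTop_add

theorem orderTop_add_pos {a b : Series K} (ha : 0 < a.orderTop) (hb : 0 < b.orderTop) :
    0 < (a + b).orderTop :=
  (lt_min ha hb).trans_le HahnSeries.min_orderTop_le_orderTop_add

theorem orderTop_eq_zero {a : Series K} {c : K} (hc : c ≠ 0)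
    (h : 0 < (a - algebraMap K (Series K) c).orderTop) : a.orderTop = 0 := by
  rw [← orderTop_algebraMap hc] at h ⊢
  rw [← sub_add_cancel a (algebraMap K (Series K) c)]
  exact HahnSeries.orderTop_add_eq_right h

theorem orderTop_inv_lt_zero {a : Series K} (ha : 0 < a.orderTop) (ha0 : a ≠ 0) :
    a⁻¹.orderTop < 0 := by
  by_contra! h
  have h1 : (a * a⁻¹).orderTop = 0 := by rw [mul_inv_cancel₀ ha0, HahnSeries.orderTop_one]
  rw [HahnSeries.orderTop_mul] at h1
  exact (add_pos_of_pos_of_nonneg ha h).ne' h1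

theorem orderTop_inv_pos {a : Series K} (ha : a.orderTop < 0) : 0 < a⁻¹.orderTop := by
  have ha0 : a ≠ 0 := by
    rintro rfl
    simp at ha
  by_contra! h
  have h1 : (a * a⁻¹).orderTop = 0 := by rw [mul_inv_cancel₀ ha0, HahnSeries.orderTop_one]
  rw [HahnSeries.orderTop_mul] at h1
  exact (add_neg_of_neg_of_nonpos ha h).ne h1

/-- Modulo series of positive order, the value of a polynomial at series of positive order is its
value at the origin. -/
theorem orderTop_aeval_sub_pos {w : Fin 2 → Series K} (hw : ∀ i, 0 < (w i).orderTop)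
    (Q : Poly2 K) :
    0 < (MvPolynomial.aeval w Q - algebraMap K (Series K) (MvPolynomial.eval 0 Q)).orderTop := by
  induction Q using MvPolynomial.induction_on with
  | C c => simp
  | add p q hp hq =>
    rw [map_add, map_add, map_add, add_sub_add_comm]
    exact orderTop_add_pos hp hq
  | mul_X p i hp =>
    have h0 : 0 ≤ (MvPolynomial.aeval w p).orderTop := by
      rw [← sub_add_cancel (MvPolynomial.aeval w p)]
      exact orderTop_add_nonneg hp.le (orderTop_algebraMap_nonneg _)
    simp only [map_mul, MvPolynomial.aeval_X, MvPolynomial.eval_X, Pi.zero_apply, mul_zero,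
      map_zero, sub_zero, HahnSeries.orderTop_mul]
    rw [add_comm]
    exact add_pos_of_pos_of_nonneg (hw i) h0

theorem orderTop_polynomial_aeval_sub_pos {w : Series K} (hw : 0 < w.orderTop)
    (q : Polynomial K) :
    0 < (Polynomial.aeval w q - algebraMap K (Series K) (q.eval 0)).orderTop := by
  have h := orderTop_aeval_sub_pos (w := fun _ => w) (fun _ => hw)
    (Polynomial.aeval (MvPolynomial.X 0) q)
  have h1 : MvPolynomial.aeval (fun _ : Fin 2 => w)
      (Polynomial.aeval (MvPolynomial.X 0 : Poly2 K) q) = Polynomial.aeval w q := by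
    rw [← Polynomial.aeval_algHom_apply, MvPolynomial.aeval_X]
  have h2 : MvPolynomial.eval (0 : Fin 2 → K)
      (Polynomial.aeval (MvPolynomial.X 0 : Poly2 K) q) = q.eval 0 := by
    rw [← MvPolynomial.coe_aeval_eq_eval, RingHom.coe_coe, ← Polynomial.aeval_algHom_apply,
      MvPolynomial.aeval_X]
    simp
  rwa [h1, h2] at h

theorem orderTop_aeval_pos {w : Series K} (hw : 0 < w.orderTop) {q : Polynomial K}
    (hq : q.eval 0 = 0) : 0 < (Polynomial.aeval w q).orderTop := by
  simpa [hq] using orderTop_polynomial_aeval_sub_pos hw q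

theorem orderTop_aeval_eq_zero {w : Series K} (hw : 0 < w.orderTop) {q : Polynomial K}
    (hq : q.eval 0 ≠ 0) : (Polynomial.aeval w q).orderTop = 0 :=
  orderTop_eq_zero hq (orderTop_polynomial_aeval_sub_pos hw q)

theorem orderTop_aeval_nonneg {w : Series K} (hw : 0 < w.orderTop) (q : Polynomial K) :
    0 ≤ (Polynomial.aeval w q).orderTop := by
  by_cases hq : q.eval 0 = 0
  · exact (orderTop_aeval_pos hw hq).le
  · exact (orderTop_aeval_eq_zero hw hq).ge

/-- Split off the power of the variable from a nonzero polynomial: the cofactor has nonzero constant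
term, so its value at `w` has order zero. -/
theorem transcendental_of_orderTop_pos {w : Series K} (hw : 0 < w.orderTop) (hw0 : w ≠ 0) :
    Transcendental K w := by
  rw [transcendental_iff]
  intro q hq
  by_contra hq0
  obtain ⟨q', hq', hnd⟩ := Polynomial.exists_eq_pow_rootMultiplicity_mul_and_not_dvd q hq0 0
  rw [Polynomial.dvd_iff_isRoot, Polynomial.IsRoot.def] at hnd
  rw [hq', map_mul, map_pow, map_sub, Polynomial.aeval_X, Polynomial.C_0, map_zero, sub_zero,
    mul_eq_zero] at hq
  have h2 := orderTop_aeval_eq_zero hw hnd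
  rcases hq with h | h
  · exact pow_ne_zero _ hw0 h
  · simp [h] at h2

/-- Homogeneous coordinates near `c`, in terms of a local parameter `w`. -/
def localCoords {A : Type*} [CommRing A] [Algebra K A] : OnePoint K → A → Fin 2 → A
  | ∞, w => ![w, 1]
  | (s : K), w => ![1, algebraMap K A s + w]

/-- The point with local parameter `w` near `c`. -/
def localPoint {L : Type*} [Field L] [Algebra K L] : OnePoint K → L → L
  | ∞, w => w⁻¹
  | (s : K), w => algebraMap K L s + w

/-- A transformation that maps `∞` to `c`. -/
def chart : OnePoint K → GL (Fin 2) K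
  | ∞ => 1
  | (s : K) => Matrix.GeneralLinearGroup.mkOfDetNeZero !![s, 1; 1, 0] (by simp)

open Classical in
theorem chart_inv_smul (c : OnePoint K) : (chart c)⁻¹ • c = ∞ := by
  rw [inv_smul_eq_iff]
  induction c using OnePoint.rec with
  | infty => exact (one_smul _ _).symm
  | coe s =>
    rw [OnePoint.smul_infty_eq_ite]
    simp [chart, Matrix.GeneralLinearGroup.mkOfDetNeZero]

theorem chart_denom_ne_zero {L : Type*} [Field L] [Algebra K L] (c : OnePoint K) {w : L}
    (hw : w ≠ 0) :
    algebraMap K L (chart c 1 0) * w⁻¹ + algebraMap K L (chart c 1 1) ≠ 0 := by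
  induction c using OnePoint.rec with
  | infty => simp [chart]
  | coe s => simpa [chart, Matrix.GeneralLinearGroup.mkOfDetNeZero] using hw

theorem moebius_chart {L : Type*} [Field L] [Algebra K L] (c : OnePoint K) {w : L}
    (hw : w ≠ 0) : moebius (chart c) w⁻¹ = localPoint c w := by
  induction c using OnePoint.rec with
  | infty => simp [chart, moebius, localPoint]
  | coe s =>
    simp [chart, moebius, localPoint, Matrix.GeneralLinearGroup.mkOfDetNeZero]
    field_simp

theorem localCoords_zero_ne_zero {L : Type*} [Field L] [Algebra K L] (c : OnePoint K) {w : L}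
    (hw : w ≠ 0) : localCoords c w 0 ≠ 0 := by
  induction c using OnePoint.rec with
  | infty => simpa [localCoords] using hw
  | coe s => simp [localCoords]

theorem localCoords_div {L : Type*} [Field L] [Algebra K L] (c : OnePoint K) (w : L) :
    localCoords c w 1 / localCoords c w 0 = localPoint c w := by
  induction c using OnePoint.rec with
  | infty => simp [localCoords, localPoint]
  | coe s => simp [localCoords, localPoint]

theorem localCoords_self_zero (c : OnePoint K) : localCoords c (0 : K) = coords c := by
  induction c using OnePoint.rec with
  | infty => simp [localCoords, coords]
  | coe s => simp [localCoords, coords]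

theorem map_localCoords {A B : Type*} [CommRing A] [Algebra K A] [CommRing B] [Algebra K B]
    (θ : A →ₐ[K] B) (c : OnePoint K) (w : A) (i : Fin 2) :
    θ (localCoords c w i) = localCoords c (θ w) i := by
  induction c using OnePoint.rec with
  | infty => fin_cases i <;> simp [localCoords]
  | coe s => fin_cases i <;> simp [localCoords]

theorem transcendental_localPoint {w : Series K} (hw : 0 < w.orderTop) (hw0 : w ≠ 0)
    (c : OnePoint K) : Transcendental K (localPoint c w) := by
  have h := transcendental_of_orderTop_pos hw hw0
  induction c using OnePoint.rec with
  | infty =>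
    intro h'
    exact h (IsAlgebraic.inv_iff.1 h')
  | coe s =>
    intro h'
    refine h ?_
    have := h'.sub (isAlgebraic_algebraMap (R := K) (A := Series K) s)
    simpa [localPoint] using this

theorem orderTop_neg_of_mul_eq {t D N : Series K} (h : t * D = N) (hD : 0 < D.orderTop)
    (hN : N.orderTop = 0) : t.orderTop < 0 := by
  by_contra! ht
  rw [← h, HahnSeries.orderTop_mul, add_comm] at hN
  exact (add_pos_of_pos_of_nonneg hD ht).ne' hN

theorem orderTop_nonneg_of_mul_eq {t D N : Series K} (h : t * D = N) (hD : D.orderTop = 0)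
    (hN : 0 ≤ N.orderTop) : 0 ≤ t.orderTop := by
  rwa [← h, HahnSeries.orderTop_mul, hD, add_zero] at hN

theorem orderTop_pow_pos {w : Series K} (hw : 0 < w.orderTop) {n : ℕ} (hn : n ≠ 0) :
    0 < (w ^ n).orderTop := by
  have := orderTop_aeval_pos hw (q := Polynomial.X ^ n) (by simp [hn])
  simpa using this

theorem orderTop_pow_nonneg {w : Series K} (hw : 0 < w.orderTop) (n : ℕ) :
    0 ≤ (w ^ n).orderTop := by
  simpa using orderTop_aeval_nonneg hw (Polynomial.X ^ n : Polynomial K)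

/-- A univariate rational function has a pole at `c` if and only if its value at a generic point
near `c` has negative order. -/
theorem isPoleOf_iff {w : Series K} (hw : 0 < w.orderTop) (hw0 : w ≠ 0) (f : RatFunc K)
    (c : OnePoint K) :
    IsPoleOf f c ↔ (Polynomial.aeval (localPoint c w) f.num /
      Polynomial.aeval (localPoint c w) f.denom).orderTop < 0 := by
  have hden : Polynomial.aeval (localPoint c w) f.denom ≠ 0 := fun h =>
    f.denom_ne_zero (transcendental_iff.1 (transcendental_localPoint hw hw0 c) _ h)
  set t := Polynomial.aeval (localPoint c w) f.num /
      Polynomial.aeval (localPoint c w) f.denom with ht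
  have htm : t * Polynomial.aeval (localPoint c w) f.denom =
      Polynomial.aeval (localPoint c w) f.num := div_mul_cancel₀ _ hden
  clear_value t
  induction c using OnePoint.rec with
  | infty =>
    change f.denom.natDegree < f.num.natDegree ↔ _
    by_cases hn : f.num = 0
    · rw [hn, map_zero, mul_eq_zero, or_iff_left hden] at htm
      simp [hn, htm]
    -- At infinity, `q(1/w)` is `w ^ (-deg q)` times the reversed polynomial at `w`, which has order
    -- zero since its constant term is the leading coefficient of `q`.
    have hrev : ∀ q : Polynomial K, Polynomial.aeval w q.reverse =
        w ^ q.natDegree * Polynomial.aeval (localPoint (∞ : OnePoint K) w) q := by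
      intro q
      let _ : Invertible w⁻¹ := invertibleOfNonzero (inv_ne_zero hw0)
      have h := Polynomial.eval₂_reverse_mul_pow (algebraMap K (Series K)) w⁻¹ q
      rw [invOf_eq_inv, inv_inv, ← Polynomial.aeval_def, ← Polynomial.aeval_def] at h
      have hpt : localPoint (∞ : OnePoint K) w = w⁻¹ := rfl
      rw [hpt, ← h, mul_comm, mul_assoc, ← mul_pow, inv_mul_cancel₀ hw0, one_pow, mul_one]
    have hord : ∀ q : Polynomial K, q ≠ 0 → (Polynomial.aeval w q.reverse).orderTop = 0 := by
      intro q hq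
      refine orderTop_aeval_eq_zero hw ?_
      rw [← Polynomial.coeff_zero_eq_eval_zero, Polynomial.coeff_zero_reverse]
      simpa using hq
    have hN := hord _ hn
    have hD := hord _ f.denom_ne_zero
    have key : t * Polynomial.aeval w f.denom.reverse * w ^ f.num.natDegree =
        Polynomial.aeval w f.num.reverse * w ^ f.denom.natDegree := by
      rw [hrev, hrev, ← htm]
      ring
    constructor
    · intro hlt
      obtain ⟨k, hk⟩ := Nat.exists_eq_add_of_lt hlt
      refine orderTop_neg_of_mul_eq (D := Polynomial.aeval w f.denom.reverse * w ^ (k + 1))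
        (N := Polynomial.aeval w f.num.reverse) ?_ ?_ hN
      · refine mul_right_cancel₀ (pow_ne_zero f.denom.natDegree hw0) ?_
        rw [← key, hk]
        ring
      · rw [HahnSeries.orderTop_mul, hD, zero_add]
        exact orderTop_pow_pos hw (Nat.succ_ne_zero k)
    · intro hlt
      by_contra! hle
      obtain ⟨k, hk⟩ := Nat.exists_eq_add_of_le hle
      refine hlt.not_ge (orderTop_nonneg_of_mul_eq (D := Polynomial.aeval w f.denom.reverse)
        (N := Polynomial.aeval w f.num.reverse * w ^ k) ?_ hD ?_)
      · refine mul_right_cancel₀ (pow_ne_zero f.num.natDegree hw0) ?_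
        rw [key, hk]
        ring
      · rw [HahnSeries.orderTop_mul, hN, zero_add]
        exact orderTop_pow_nonneg hw k
  | coe s =>
    change f.denom.eval s = 0 ↔ _
    have hval : ∀ q : Polynomial K, Polynomial.aeval (localPoint (s : OnePoint K) w) q =
        Polynomial.aeval w (Polynomial.taylor s q) := by
      intro q
      rw [Polynomial.taylor_apply, Polynomial.aeval_comp]
      simp [localPoint, add_comm]
    have hev : ∀ q : Polynomial K, (Polynomial.taylor s q).eval 0 = q.eval s := by
      intro q
      rw [Polynomial.taylor_eval, zero_add]
    rw [hval, hval] at htm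
    constructor
    · intro h0
      refine orderTop_neg_of_mul_eq htm (orderTop_aeval_pos hw (by rwa [hev]))
        (orderTop_aeval_eq_zero hw ?_)
      rw [hev]
      intro h1
      obtain ⟨a, b, hab⟩ := f.isCoprime_num_denom
      have := congrArg (Polynomial.eval s) hab
      simp [h0, h1] at this
    · intro hlt
      by_contra h0
      exact hlt.not_ge (orderTop_nonneg_of_mul_eq htm
        (orderTop_aeval_eq_zero hw (by rwa [hev])) (orderTop_aeval_nonneg hw _))

end Local

/-! ### Branches of the curve and the transfer of poles -/

section Curve

variable {K : Type*} [Field K]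

/-- The bi-homogenization of `p`, evaluated in a `K`-algebra. -/
def evalBiHom {A : Type*} [CommRing A] [Algebra K A] (p : Poly2 K) (z : Fin 2 → Fin 2 → A) : A :=
  ∑ m ∈ p.support, algebraMap K A (p.coeff m) *
    ∏ i, (z i 0 ^ (p.degreeOf i - m i) * z i 1 ^ m i)

theorem evalBiHom_self (p : Poly2 K) (z : Fin 2 → Fin 2 → K) :
    evalBiHom p z = biHom p (z 0) (z 1) := by
  simp [evalBiHom, biHom, Fin.prod_univ_two, mul_assoc]

theorem map_evalBiHom {A B : Type*} [CommRing A] [Algebra K A] [CommRing B] [Algebra K B]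
    (θ : A →ₐ[K] B) (p : Poly2 K) (z : Fin 2 → Fin 2 → A) :
    θ (evalBiHom p z) = evalBiHom p fun i j => θ (z i j) := by
  simp only [evalBiHom, map_sum, map_mul, map_prod, map_pow, AlgHom.commutes]

theorem evalBiHom_eq_prod_mul {L : Type*} [Field L] [Algebra K L] (p : Poly2 K)
    (z : Fin 2 → Fin 2 → L) (hz : ∀ i, z i 0 ≠ 0) :
    evalBiHom p z = (∏ i, z i 0 ^ p.degreeOf i) *
      MvPolynomial.aeval (fun i => z i 1 / z i 0) p := by
  rw [MvPolynomial.aeval_def, MvPolynomial.eval₂_eq', Finset.mul_sum, evalBiHom]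
  refine Finset.sum_congr rfl fun m hm => ?_
  rw [mul_left_comm, ← Finset.prod_mul_distrib]
  congr 1
  refine Finset.prod_congr rfl fun i _ => ?_
  have hle : m i ≤ p.degreeOf i := MvPolynomial.monomial_le_degreeOf i hm
  obtain ⟨k, hk⟩ := Nat.exists_eq_add_of_le hle
  rw [hk, Nat.add_sub_cancel_left, div_pow, pow_add]
  field_simp [hz i]

theorem map_evalBiHom_localCoords {A B : Type*} [CommRing A] [Algebra K A] [CommRing B]
    [Algebra K B] (θ : A →ₐ[K] B) (p : Poly2 K) (c : Fin 2 → OnePoint K) (w : Fin 2 → A) :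
    θ (evalBiHom p fun i => localCoords (c i) (w i)) =
      evalBiHom p fun i => localCoords (c i) (θ (w i)) := by
  rw [map_evalBiHom]
  congr 1
  ext i j
  exact map_localCoords θ _ _ _

/-- Links the equation in local parameters, which also makes sense at infinity, with `p` itself; `u`
collects the cleared denominators. -/
theorem evalBiHom_localCoords {L : Type*} [Field L] [Algebra K L] (p : Poly2 K)
    (c : Fin 2 → OnePoint K) (w : Fin 2 → L) (hw : ∀ i, w i ≠ 0) :
    ∃ u ≠ 0, evalBiHom p (fun i => localCoords (c i) (w i)) =
      u * MvPolynomial.aeval (fun i => localPoint (c i) (w i)) p := by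
  refine ⟨∏ i, localCoords (c i) (w i) 0 ^ p.degreeOf i,
    Finset.prod_ne_zero_iff.2 fun i _ => pow_ne_zero _ (localCoords_zero_ne_zero _ (hw i)), ?_⟩
  rw [evalBiHom_eq_prod_mul p _ fun i => localCoords_zero_ne_zero _ (hw i)]
  simp only [localCoords_div]

/-- If `p` vanishes at series of negative order, then `(∞, ∞)` lies on its curve. -/
theorem infty_mem_curve {p : Poly2 K} {a b : Series K} (ha : a.orderTop < 0)
    (hb : b.orderTop < 0) (h : MvPolynomial.aeval ![a, b] p = 0) :
    ((∞, ∞) : OnePoint K × OnePoint K) ∈ curve p := by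
  let w : Fin 2 → Series K := ![a⁻¹, b⁻¹]
  have hw : ∀ i, 0 < (w i).orderTop := by
    intro i
    fin_cases i
    · exact orderTop_inv_pos ha
    · exact orderTop_inv_pos hb
  have hw0 : ∀ i, w i ≠ 0 := by
    intro i
    have ha0 : a ≠ 0 := by rintro rfl; simp at ha
    have hb0 : b ≠ 0 := by rintro rfl; simp at hb
    fin_cases i
    · exact inv_ne_zero ha0
    · exact inv_ne_zero hb0
  -- The equation of the curve in the local parameters at `(∞, ∞)`. It vanishes at series of
  -- positive order, so its constant term is zero.
  let Q : Poly2 K := evalBiHom p fun i => localCoords (∞ : OnePoint K) (MvPolynomial.X i)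
  have hQw : MvPolynomial.aeval w Q = 0 := by
    obtain ⟨u, -, hu⟩ := evalBiHom_localCoords p (fun _ => ∞) w hw0
    have hpt : (fun i => localPoint (∞ : OnePoint K) (w i)) = ![a, b] := by
      ext1 i
      fin_cases i <;> simp [localPoint, w]
    rw [map_evalBiHom_localCoords]
    simp only [MvPolynomial.aeval_X]
    rw [hu, hpt, h, mul_zero]
  have hQ0 : MvPolynomial.eval 0 Q = biHom p (coords ∞) (coords ∞) := by
    have := map_evalBiHom_localCoords (MvPolynomial.aeval (0 : Fin 2 → K)) p (fun _ => ∞)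
      MvPolynomial.X
    simp only [MvPolynomial.aeval_X, Pi.zero_apply, localCoords_self_zero] at this
    rw [← evalBiHom_self p fun _ => coords ∞, ← this]
    rfl
  have hpos := orderTop_aeval_sub_pos hw Q
  rw [hQw, zero_sub, HahnSeries.orderTop_neg] at hpos
  change biHom p (coords ∞) (coords ∞) = 0
  rw [← hQ0]
  by_contra hne
  exact hpos.ne' (orderTop_algebraMap hne)

theorem degreeOf_le_of_dvd {p q : Poly2 K} (hq : q ≠ 0) (h : p ∣ q) (i : Fin 2) :
    p.degreeOf i ≤ q.degreeOf i := by
  obtain ⟨c, rfl⟩ := h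
  rw [MvPolynomial.degreeOf_mul_eq (left_ne_zero_of_mul hq) (right_ne_zero_of_mul hq)]
  exact Nat.le_add_right _ _

/-- The curve does not contain the line on which the coordinate `i` is constant. -/
theorem evalBiHom_localCoords_ne_zero {p : Poly2 K} (hp : Irreducible p)
    (hdeg : ∀ k, 0 < p.degreeOf k) {i j : Fin 2} (hij : i ≠ j) (c : Fin 2 → OnePoint K)
    {w : Fin 2 → Series K} (hi : w i = 0) (hj : 0 < (w j).orderTop) (hj0 : w j ≠ 0) :
    evalBiHom p (fun k => localCoords (c k) (w k)) ≠ 0 := by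
  classical
  have htr := transcendental_localPoint hj hj0 (c j)
  have hcase : ∀ k, k = i ∨ k = j := by
    intro k
    omega
  generalize hci : c i = ci
  induction ci using OnePoint.rec with
  | infty =>
    -- On the line at infinity only the leading coefficient with respect to variable `i` survives;
    -- it is a nonzero polynomial in variable `j`.
    let q : Polynomial K := ∑ m ∈ p.support.filter fun m => m i = p.degreeOf i,
      Polynomial.monomial (m j) (p.coeff m)
    have hq : q ≠ 0 := by
      obtain ⟨m, hm, hmi⟩ : ∃ m ∈ p.support, p.degreeOf i = m i := by
        rw [MvPolynomial.degreeOf_eq_sup]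
        exact Finset.exists_mem_eq_sup _ (by simpa using hp.ne_zero) _
      intro h0
      have h1 := congrArg (fun q => Polynomial.coeff q (m j)) h0
      simp only [q, Polynomial.finsetSum_coeff, Polynomial.coeff_monomial,
        Polynomial.coeff_zero] at h1
      rw [Finset.sum_eq_single m] at h1
      · simp only [if_true] at h1
        exact MvPolynomial.mem_support_iff.1 hm h1
      · intro m' hm' hne
        refine if_neg fun hmj => hne ?_
        ext k
        rcases hcase k with rfl | rfl
        · rw [(Finset.mem_filter.1 hm').2, hmi]
        · exact hmj
      · intro hnot
        exact absurd (Finset.mem_filter.2 ⟨hm, hmi.symm⟩) hnot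
    have hsum : evalBiHom p (fun k => localCoords (c k) (w k)) =
        localCoords (c j) (w j) 0 ^ p.degreeOf j *
          Polynomial.aeval (localPoint (c j) (w j)) q := by
      have huniv : (Finset.univ : Finset (Fin 2)) = {i, j} := by
        ext k
        simpa using hcase k
      rw [evalBiHom, map_sum, Finset.mul_sum, Finset.sum_filter]
      refine Finset.sum_congr rfl fun m hm => ?_
      have hlj : m j ≤ p.degreeOf j := MvPolynomial.monomial_le_degreeOf j hm
      have hli : m i ≤ p.degreeOf i := MvPolynomial.monomial_le_degreeOf i hm
      have hinf : localCoords (∞ : OnePoint K) (0 : Series K) = ![0, 1] := rfl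
      rw [huniv, Finset.prod_pair hij, hci, hi, hinf, Polynomial.aeval_monomial]
      split_ifs with hmi
      · obtain ⟨k, hk⟩ := Nat.exists_eq_add_of_le hlj
        have h0 := localCoords_zero_ne_zero (c j) hj0
        rw [← localCoords_div, hmi, hk, Nat.sub_self, Nat.add_sub_cancel_left, div_pow, pow_add]
        simp only [Matrix.cons_val_zero, Matrix.cons_val_one, pow_zero, one_pow]
        field_simp
      · have hne : p.degreeOf i - m i ≠ 0 := by omega
        simp [hne]
    rw [hsum]
    exact mul_ne_zero (pow_ne_zero _ (localCoords_zero_ne_zero _ hj0))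
      fun h => hq (transcendental_iff.1 htr _ h)
  | coe s =>
    have hz : ∀ k, localCoords (c k) (w k) 0 ≠ 0 := by
      intro k
      rcases hcase k with rfl | rfl
      · rw [hci]
        simp [localCoords]
      · exact localCoords_zero_ne_zero _ hj0
    rw [evalBiHom_eq_prod_mul _ _ hz]
    refine mul_ne_zero (Finset.prod_ne_zero_iff.2 fun k _ => pow_ne_zero _ (hz k)) fun h => ?_
    simp only [localCoords_div] at h
    -- If `p` vanished on this line, it would divide `X i - s`, contradicting its positive degree in
    -- variable `j`.
    refine aeval_ne_zero_of_not_dvd (d := MvPolynomial.X i - MvPolynomial.C s) hp hij (hdeg i)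
      (v := fun k => localPoint (c k) (w k)) htr h ?_ ?_
    · intro hdvd
      have hXC : (MvPolynomial.X i - MvPolynomial.C s : Poly2 K) ≠ 0 := by
        intro h0
        have := congrArg (MvPolynomial.eval fun _ => s + 1) h0
        simp at this
      have h1 := degreeOf_le_of_dvd hXC hdvd j
      have h2 : (MvPolynomial.X i - MvPolynomial.C s : Poly2 K).degreeOf j = 0 := by
        refine Nat.le_zero.1 ((MvPolynomial.degreeOf_sub_le _ _ _).trans ?_)
        rw [MvPolynomial.degreeOf_C, MvPolynomial.degreeOf_X, if_neg hij.symm]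
        simp
      have := hdeg j
      omega
    · simp [hci, hi, localPoint]

open Polynomial in
/-- Every point of the curve is the center of a parametrization by Puiseux series. -/
theorem exists_parametrization [IsAlgClosed K] [CharZero K] {p : Poly2 K} (hp : Irreducible p)
    (hdeg : ∀ k, 0 < p.degreeOf k) (c : Fin 2 → OnePoint K) (hc : (c 0, c 1) ∈ curve p) :
    ∃ ψ : Series K, IsPuiseux ψ⁻¹ ∧ 0 < ψ.orderTop ∧ ψ ≠ 0 ∧
      MvPolynomial.aeval
        ![localPoint (c 0) (HahnSeries.single 1 1 : Series K), localPoint (c 1) ψ] p = 0 := by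
  set u : Series K := HahnSeries.single 1 1 with hu
  have hupos : 0 < u.orderTop := by
    rw [hu, HahnSeries.orderTop_single one_ne_zero]
    exact zero_lt_one
  have hu0 : u ≠ 0 := HahnSeries.single_ne_zero one_ne_zero
  -- The local equation at `c`: the inner variable is the parameter of the first coordinate, the
  -- outer one that of the second.
  let h : K[X][X] := evalBiHom p fun i => localCoords (c i) ((![C Polynomial.X, Polynomial.X] :
    Fin 2 → K[X][X]) i)
  have hθ : ∀ {B : Type _} [CommRing B] [Algebra K B] (a b : B),
      h.eval₂ (aeval a : K[X] →ₐ[K] B) b =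
        evalBiHom p fun i => localCoords (c i) ((![a, b] : Fin 2 → B) i) := by
    intro B _ _ a b
    let θ : K[X][X] →ₐ[K] B := eval₂AlgHom (aeval a) b fun _ => Commute.all _ _
    have := map_evalBiHom_localCoords θ p c ![C Polynomial.X, Polynomial.X]
    change θ h = _
    rw [this]
    congr 1
    ext i j
    congr 1
    fin_cases i <;> simp [θ]
  have hzero : (h.coeff 0).eval 0 = 0 := by
    have h1 := hθ (0 : K) 0
    have h2 : (evalBiHom p fun i => localCoords (c i) ((![0, 0] : Fin 2 → K) i)) = 0 := by
      rw [evalBiHom_self]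
      simp only [Matrix.cons_val_zero, Matrix.cons_val_one, localCoords_self_zero]
      exact hc
    rw [h2, eval₂_at_zero] at h1
    simpa using h1
  have hne : h.map (evalRingHom 0) ≠ 0 := by
    intro h0
    refine evalBiHom_localCoords_ne_zero hp hdeg zero_ne_one c (w := ![0, u]) rfl hupos hu0 ?_
    rw [← hθ]
    have hcomp : ((aeval (0 : Series K) : K[X] →ₐ[K] Series K) : K[X] →+* Series K) =
        (algebraMap K (Series K)).comp (evalRingHom 0) := by
      refine Polynomial.ringHom_ext (fun a => ?_) ?_ <;> simp
    rw [hcomp, ← eval₂_map, h0, eval₂_zero]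
  obtain ⟨ψ, h1, h2, h3⟩ := exists_series_root h hzero hne
  rw [hθ] at h3
  have hψ0 : ψ ≠ 0 := by
    intro h0
    exact evalBiHom_localCoords_ne_zero hp hdeg one_ne_zero c (w := ![u, ψ]) h0 hupos hu0 h3
  refine ⟨ψ, h1, h2, hψ0, ?_⟩
  obtain ⟨t, ht, ht'⟩ := evalBiHom_localCoords p c ![u, ψ] (by
    intro i
    fin_cases i
    · exact hu0
    · exact hψ0)
  rw [ht', mul_eq_zero, or_iff_right ht] at h3
  rw [← h3]
  congr 2
  ext1 i
  fin_cases i <;> rfl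

/-- At a point of the curve that is not a pole of `r`, either both or none of `f` and `g` have a
pole. -/
theorem isPoleOf_iff_isPoleOf [IsAlgClosed K] [CharZero K] {p : Poly2 K} (hp : Irreducible p)
    (hdeg : ∀ k, 0 < p.degreeOf k) {r : Rat2 K} (hr : r ∈ localRing p) {f g : RatFunc K}
    (hfg : (f, g) ∈ F r p) (c : OnePoint K × OnePoint K) (hc : c ∈ curve p)
    (hpole : ¬ IsPole p r c) : IsPoleOf f c.1 ↔ IsPoleOf g c.2 := by
  classical
  obtain ⟨c₁, c₂⟩ := c
  obtain ⟨ψ, hpui, hψ, hψ0, hzero⟩ := exists_parametrization hp hdeg ![c₁, c₂] hc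
  set u : Series K := HahnSeries.single 1 1 with hu
  simp only [Matrix.cons_val_zero, Matrix.cons_val_one] at hzero
  have hupos : 0 < u.orderTop := by
    rw [hu, HahnSeries.orderTop_single one_ne_zero]
    exact zero_lt_one
  have hu0 : u ≠ 0 := HahnSeries.single_ne_zero one_ne_zero
  have hx : xSeries = u⁻¹ := by
    refine eq_inv_of_mul_eq_one_left ?_
    simp [hu, xSeries]
  have hxneg : (xSeries : Series K).orderTop < 0 := by
    rw [hx]
    exact orderTop_inv_lt_zero hupos hu0
  set a := localPoint c₁ u with ha
  set b := localPoint c₂ ψ with hb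
  have hden : ∀ d : Poly2 K, ¬ p ∣ d → MvPolynomial.aeval ![a, b] d ≠ 0 := fun d hd =>
    aeval_ne_zero_of_not_dvd hp (i := 0) (j := 1) zero_ne_one (hdeg 0)
      (transcendental_localPoint hψ hψ0 c₂) hzero hd
  have hvp : IsValue a b (algebraMap (Poly2 K) (Rat2 K) p) 0 := by
    rw [← hzero]
    exact isValue_algebraMap a b p
  have hvr : IsValue a b r (subst r a b) := isValue_subst (hden _ hr)
  have ha' : moebius (chart c₁) (xSeries : Series K) = a := by
    rw [hx, moebius_chart c₁ hu0]
  have hb' : moebius (chart c₂) ψ⁻¹ = b := moebius_chart c₂ hψ0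
  -- The charts carry the branch `(x, ψ⁻¹)` at `(∞, ∞)` to the branch `(a, b)` at the given point.
  have hcomp : ∀ {ρ : Rat2 K} {t : Series K}, IsValue a b ρ t →
      IsValue xSeries ψ⁻¹ (compInv ρ (chart c₁)⁻¹ (chart c₂)⁻¹) t := by
    intro ρ t h
    have := isValue_compInv (ρ := ρ) (a := (xSeries : Series K)) (b := ψ⁻¹)
      (chart c₁)⁻¹ (chart c₂)⁻¹
      (by rw [inv_inv, hx]; exact chart_denom_ne_zero c₁ hu0)
      (by rw [inv_inv]; exact chart_denom_ne_zero c₂ hψ0)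
      (by rw [inv_inv, inv_inv, ha', hb']; exact h.den_ne_zero)
    rwa [inv_inv, inv_inv, ha', hb', h.subst_eq] at this
  -- Otherwise the inverse charts, with the branch `ψ⁻¹`, would exhibit a pole of `r`.
  have hR : 0 ≤ (subst r a b).orderTop := by
    by_contra! hneg
    refine hpole ⟨(chart c₁)⁻¹, (chart c₂)⁻¹, chart_inv_smul c₁, chart_inv_smul c₂, ?_⟩
    have h0 : MvPolynomial.aeval ![xSeries, ψ⁻¹] (num (compInv
        (algebraMap (Poly2 K) (Rat2 K) p) (chart c₁)⁻¹ (chart c₂)⁻¹)) = 0 := by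
      have h1 := (hcomp hvp).subst_eq
      rw [subst, div_eq_zero_iff] at h1
      exact h1.resolve_right (hcomp hvp).den_ne_zero
    refine ⟨infty_mem_curve hxneg (orderTop_inv_lt_zero hψ hψ0) h0, ψ⁻¹, hpui, h0,
      orderTop_inv_lt_zero hψ hψ0, ?_⟩
    rwa [(hcomp hvr).subst_eq]
  rw [isPoleOf_iff hupos hu0, isPoleOf_iff hψ hψ0]
  simp only [← ha, ← hb]
  obtain ⟨q, hq, heq⟩ := hfg
  have hvf := (isValue_X (K := K) a b).ratFunc_eval f fun h =>
    f.denom_ne_zero (transcendental_iff.1 (transcendental_localPoint hupos hu0 c₁) _ h)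
  have hvg := (isValue_Y (K := K) a b).ratFunc_eval g fun h =>
    g.denom_ne_zero (transcendental_iff.1 (transcendental_localPoint hψ hψ0 c₂) _ h)
  -- As `p` vanishes on the branch, this becomes `r(a, b) = f(a) - g(b)`.
  have h1 := (hvf.sub hvg).subst_eq
  change subst (inX f - inY g) a b = _ at h1
  rw [heq, (hvr.add ((isValue_subst (hden _ hq)).mul hvp)).subst_eq, mul_zero, add_zero] at h1
  rw [← not_iff_not, not_lt, not_lt]
  constructor
  · intro h
    rw [← sub_sub_cancel (Polynomial.aeval a f.num / Polynomial.aeval a f.denom)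
      (Polynomial.aeval b g.num / Polynomial.aeval b g.denom), ← h1, sub_eq_add_neg]
    exact orderTop_add_nonneg h (by rwa [HahnSeries.orderTop_neg])
  · intro h
    rw [← sub_add_cancel (Polynomial.aeval a f.num / Polynomial.aeval a f.denom)
      (Polynomial.aeval b g.num / Polynomial.aeval b g.denom), ← h1]
    exact orderTop_add_nonneg hR h

theorem finite_isPoleOf (f : RatFunc K) : {c | IsPoleOf f c}.Finite := by
  refine ((f.denom.rootSet_finite K).image (OnePoint.some)).insert ∞ |>.subset fun c hc => ?_
  induction c using OnePoint.rec with
  | infty => exact Set.mem_insert _ _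
  | coe s =>
    refine Set.mem_insert_of_mem _ ⟨s, ?_, rfl⟩
    rw [Polynomial.mem_rootSet]
    exact ⟨f.denom_ne_zero, by simpa using! hc⟩

end Curve

/-! ### Propagation along the path and conclusion -/

/-- If the two coordinates of each vertex but the initial one of an infinite path without cycles
either both or none belong to given finite sets, then they do not belong to them. -/
theorem not_of_propagates {α β : Type*} {v : ℕ → α × β} (hinj : Function.Injective v)
    (hshare : ∀ i, (v i).1 = (v (i + 1)).1 ∨ (v i).2 = (v (i + 1)).2) {P : α → Prop} {Q : β → Prop}
    (hP : {a | P a}.Finite) (hQ : {b | Q b}.Finite)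
    (hPQ : ∀ i, 0 < i → (P (v i).1 ↔ Q (v i).2)) : ¬ P (v 1).1 := by
  intro h1
  -- The index is shifted since the equivalence is not available at `v 0`. The shared coordinate
  -- passes its property on, and the equivalence supplies the other one.
  have hall : ∀ i, P (v (i + 1)).1 ∧ Q (v (i + 1)).2 := by
    intro i
    induction i with
    | zero => exact ⟨h1, (hPQ 1 one_pos).1 h1⟩
    | succ i ih =>
      have := hPQ (i + 1 + 1) (by omega)
      rcases hshare (i + 1) with h | h
      · have hp := h ▸ ih.1
        exact ⟨hp, this.1 hp⟩
      · have hq := h ▸ ih.2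
        exact ⟨this.2 hq, hq⟩
  refine Set.infinite_range_of_injective (hinj.comp (add_left_injective 1))
    ((hP.prod hQ).subset ?_)
  rintro _ ⟨i, rfl⟩
  exact hall i

end SepVar

end

theorem mainTheorem7 {K : Type*} [Field K] [IsAlgClosed K] [CharZero K]
    (p : SepVar.Poly2 K) (hp : Irreducible p)
    (hpx : 0 < p.degreeOf 0) (hpy : 0 < p.degreeOf 1)
    (r : SepVar.Rat2 K) (hr : r ∈ SepVar.localRing p)
    (f g : RatFunc K) (hfg : (f, g) ∈ SepVar.F r p)
    (s : SepVar.curve p) (hs : SepVar.IsPole p r s.1)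
    (v : ℕ → SepVar.orbit s) (hv : SepVar.IsInfinitePath (SepVar.orbitGraph s) v)
    (hcycle : SepVar.CycleFree v) (hstart : (v 0).1 = s)
    (hpoles : ∀ i, SepVar.IsPole p r (v i).1.1 → (v i).1 = s) :
    (¬ SepVar.IsPoleOf f s.1.1 ∨ ¬ SepVar.IsPoleOf g s.1.2) ∧
    ((v 1).1.1.1 = s.1.1 → ¬ SepVar.IsPoleOf f s.1.1) ∧
    ((v 1).1.1.2 = s.1.2 → ¬ SepVar.IsPoleOf g s.1.2) := by
  have hdeg : ∀ k, 0 < p.degreeOf k := by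
    intro k
    fin_cases k
    · exact hpx
    · exact hpy
  have hinjv : Function.Injective v := by
    intro i j hij
    by_contra hne
    rcases Nat.lt_or_gt_of_ne hne with h | h
    · exact hcycle i (j - i) (by omega) (by rw [Nat.add_sub_cancel' h.le, hij])
    · exact hcycle j (i - j) (by omega) (by rw [Nat.add_sub_cancel' h.le, hij])
  have hinj : Function.Injective fun i => (v i).1.1 :=
    Subtype.val_injective.comp (Subtype.val_injective.comp hinjv)
  have hiff : ∀ i, 0 < i → (SepVar.IsPoleOf f (v i).1.1.1 ↔ SepVar.IsPoleOf g (v i).1.1.2) := by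
    intro i hi
    refine SepVar.isPoleOf_iff_isPoleOf hp hdeg hr hfg _ (v i).1.2 fun hpole => ?_
    -- The only pole on the path is its start, which is not visited again.
    have h0 : v i = v 0 := Subtype.ext ((hpoles i hpole).trans hstart.symm)
    exact hi.ne' (hinjv h0)
  have hshare : ∀ i, (v i).1.1.1 = (v (i + 1)).1.1.1 ∨ (v i).1.1.2 = (v (i + 1)).1.1.2 :=
    fun i => (hv i).2
  have hf := SepVar.not_of_propagates hinj hshare (SepVar.finite_isPoleOf f)
    (SepVar.finite_isPoleOf g) hiff
  have hg : ¬ SepVar.IsPoleOf g (v 1).1.1.2 := by rwa [← hiff 1 one_pos]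
  have h2 : (v 1).1.1.1 = s.1.1 → ¬ SepVar.IsPoleOf f s.1.1 := fun h => h ▸ hf
  have h3 : (v 1).1.1.2 = s.1.2 → ¬ SepVar.IsPoleOf g s.1.2 := fun h => h ▸ hg
  refine ⟨?_, h2, h3⟩
  -- The vertices `v 0` and `v 1` share a coordinate, so one of the other two assertions applies.
  have h01 := hshare 0
  rw [hstart] at h01
  rcases h01 with h | h
  · exact Or.inl (h2 h.symm)
  · exact Or.inr (h3 h.symm)
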